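/- Let $d\ge 2$, $1\le k\le d$, and let $\lambda=(\lambda_1,\dots,\lambda_d)$ be fixed with $1\ge\lambda_1\ge\dots\ge\lambda_k>\lambda_{k+1}=\dots=\lambda_d=0$; if $k=d$, assume in addition that the $\lambda_i$ are not all equal. Put $D_\lambda=\mathrm{diag}(\lambda_1,\dots,\lambda_d)$, $s_i=\mathrm{tr}(D_\lambda^i)$, and $$a_1=\frac{d(d+2)(d-1)}{-2s_1^2+2d s_2},\qquad a_2=\frac{(d+1)s_1^2-2s_2}{-2s_1^2+2d s_2}.$$ Let $\mathscr H_d$ be the space of symmetric matrices in $\mathbb R^{d\times d}$ with $\langle X,Y\rangle=\mathrm{tr}(XY^{*})$, let $\mathcal G_{\lambda,d}=\{OD_\lambda O^{*}: O\in \mathcal O(d)\}$, and let $\sigma_{\lambda,d}$ be the probability measure on $\mathcal G_{\lambda,d}$ induced by the Haar probability measure on the orthogonal group $\mathcal O(d)$ via $O\mapsto OD_\lambda O^{*}$. Let $\mathcal P$ be a $\mathcal G_{\lambda,d}$-valued random variable which is a random cubature of strength $2$, i.e. $$\mathbb E\big(\langle \mathcal P,X\rangle^2\big)=\int_{\mathcal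 G_{\lambda,d}}\langle P,X\rangle^2\,d\sigma_{\lambda,d}(P)\qquad\text{for all }X\in\mathscr H_d .$$ Then $\mathcal S(X)=X-\frac{a_2}{1+a_2 d}\,\mathrm{tr}(X)\,I_d$ maps $\mathscr H_d$ to $\mathscr H_d$ and $$\mathcal S\big(a_1\mathbb E(\langle \mathcal P,X\rangle \mathcal P)\big)=a_1\mathbb E(\langle\mathcal P,\mathcal S X\rangle \mathcal P)=X\qquad\text{for all }X\in\mathscr H_d .$$ -/

import Mathlib

open MeasureTheory
open scoped Matrix

namespace RandomCubature

noncomputable section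

/-! Matrices carry the Borel σ-algebra of their (entrywise) topology. -/

instance instMeasurableSpaceMatrix (d : ℕ) : MeasurableSpace (Matrix (Fin d) (Fin d) ℝ) :=
  inferInstanceAs (MeasurableSpace (Fin d → Fin d → ℝ))

instance instBorelSpaceMatrix (d : ℕ) : BorelSpace (Matrix (Fin d) (Fin d) ℝ) :=
  inferInstanceAs (BorelSpace (Fin d → Fin d → ℝ))

instance instMeasurableSpaceOrthogonal (d : ℕ) :
    MeasurableSpace (Matrix.orthogonalGroup (Fin d) ℝ) :=
  Subtype.instMeasurableSpace

instance instBorelSpaceOrthogonal (d : ℕ) :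
    BorelSpace (Matrix.orthogonalGroup (Fin d) ℝ) :=
  Subtype.borelSpace _

theorem isCompact_orthogonalGroup (d : ℕ) :
    IsCompact (Matrix.orthogonalGroup (Fin d) ℝ : Set (Matrix (Fin d) (Fin d) ℝ)) := by
  have hK : IsCompact (Set.univ.pi fun _ : Fin d => Set.univ.pi fun _ : Fin d =>
      Set.Icc (-1 : ℝ) 1) :=
    isCompact_univ_pi fun _ => isCompact_univ_pi fun _ => isCompact_Icc
  refine IsCompact.of_isClosed_subset (X := Matrix (Fin d) (Fin d) ℝ) hK ?_ ?_
  · have : (Matrix.orthogonalGroup (Fin d) ℝ : Set (Matrix (Fin d) (Fin d) ℝ)) =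
        {A | A * Aᵀ = 1} := by
      ext A
      exact Matrix.mem_orthogonalGroup_iff (Fin d) ℝ
    rw [this]
    exact isClosed_eq (by fun_prop) continuous_const
  · intro A hA i _ j _
    have h := entry_norm_bound_of_unitary hA i j
    rw [Real.norm_eq_abs] at h
    exact abs_le.mp h

instance instCompactSpaceOrthogonal (d : ℕ) :
    CompactSpace (Matrix.orthogonalGroup (Fin d) ℝ) :=
  isCompact_iff_compactSpace.mp (isCompact_orthogonalGroup d)

/-- The Haar probability measure on the orthogonal group: the Haar measure that
gives the whole (compact) group mass one. -/
def orthogonalHaar (d : ℕ) : Measure (Matrix.orthogonalGroup (Fin d) ℝ) :=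
  Measure.haarMeasure ⊤

/-- The Hilbert-Schmidt inner product `⟨X, Y⟩ = tr (X Yᵀ)`. -/
def hsInner {d : ℕ} (X Y : Matrix (Fin d) (Fin d) ℝ) : ℝ :=
  (X * Yᵀ).trace

/-- `1 ≥ l₁ ≥ … ≥ l_k > l_{k+1} = … = l_d = 0` with `1 ≤ k ≤ d`. -/
structure IsSpectrum {d : ℕ} (k : ℕ) (l : Fin d → ℝ) : Prop where
  one_le : 1 ≤ k
  le_dim : k ≤ d
  le_one : ∀ i, l i ≤ 1
  antitone : Antitone l
  pos : ∀ i : Fin d, (i : ℕ) < k → 0 < l i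
  eq_zero : ∀ i : Fin d, k ≤ (i : ℕ) → l i = 0

/-- The matrix `O D_l Oᵀ`, where `D_l = diag (l₁, …, l_d)`. -/
def conjDiag {d : ℕ} (l : Fin d → ℝ) (O : Matrix.orthogonalGroup (Fin d) ℝ) :
    Matrix (Fin d) (Fin d) ℝ :=
  (O : Matrix (Fin d) (Fin d) ℝ) * Matrix.diagonal l * (O : Matrix (Fin d) (Fin d) ℝ)ᵀ

/-- The orbit `{O D_l Oᵀ : O ∈ O(d)}`. -/
def orbit {d : ℕ} (l : Fin d → ℝ) : Set (Matrix (Fin d) (Fin d) ℝ) :=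
  Set.range (conjDiag l)

/-- The invariant probability measure on `orbit l` induced by the Haar measure on `O(d)`,
seen as a measure on the space of all matrices. -/
def orbitMeasure {d : ℕ} (l : Fin d → ℝ) : Measure (Matrix (Fin d) (Fin d) ℝ) :=
  (orthogonalHaar d).map (conjDiag l)

/-- The `t`-th trace moment `E (⟨P, X⟩ ^ t)` of a random matrix `P`. -/
def traceMoment {Ω : Type*} [MeasurableSpace Ω] {d : ℕ} (μ : Measure Ω)
    (P : Ω → Matrix (Fin d) (Fin d) ℝ) (t : ℕ) (X : Matrix (Fin d) (Fin d) ℝ) : ℝ :=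
  ∫ ω, hsInner (P ω) X ^ t ∂μ

/-- The `t`-th trace moment of the invariant measure on `orbit l`. -/
def uniformTraceMoment {d : ℕ} (l : Fin d → ℝ) (t : ℕ)
    (X : Matrix (Fin d) (Fin d) ℝ) : ℝ :=
  ∫ P, hsInner P X ^ t ∂(orbitMeasure l)

/-- `P` is a random variable with values in `orbit l` whose `t`-th trace moments
coincide with those of the invariant measure at every symmetric matrix. -/
structure IsRandomCubature {Ω : Type*} [MeasurableSpace Ω] {d : ℕ} (μ : Measure Ω)
    (l : Fin d → ℝ) (t : ℕ) (P : Ω → Matrix (Fin d) (Fin d) ℝ) : Prop where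
  measurable : Measurable P
  mem_orbit : ∀ ω, P ω ∈ orbit l
  moment_eq : ∀ X : Matrix (Fin d) (Fin d) ℝ, X.IsSymm →
    traceMoment μ P t X = uniformTraceMoment l t X

/-- The (entrywise) expectation of a random matrix. -/
def expectation {Ω : Type*} [MeasurableSpace Ω] {d : ℕ} (μ : Measure Ω)
    (Y : Ω → Matrix (Fin d) (Fin d) ℝ) : Matrix (Fin d) (Fin d) ℝ :=
  Matrix.of fun i j => ∫ ω, Y ω i j ∂μ

/-- `s_i = tr (D_l ^ i)`. -/
def powerTrace {d : ℕ} (l : Fin d → ℝ) (i : ℕ) : ℝ :=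
  (Matrix.diagonal l ^ i).trace

/-- `a₁ = d (d + 2) (d - 1) / (-2 s₁² + 2 d s₂)`. -/
def a₁ {d : ℕ} (l : Fin d → ℝ) : ℝ :=
  ((d : ℝ) * ((d : ℝ) + 2) * ((d : ℝ) - 1)) /
    (-2 * powerTrace l 1 ^ 2 + 2 * (d : ℝ) * powerTrace l 2)

/-- `a₂ = ((d + 1) s₁² - 2 s₂) / (-2 s₁² + 2 d s₂)`. -/
def a₂ {d : ℕ} (l : Fin d → ℝ) : ℝ :=
  (((d : ℝ) + 1) * powerTrace l 1 ^ 2 - 2 * powerTrace l 2) /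
    (-2 * powerTrace l 1 ^ 2 + 2 * (d : ℝ) * powerTrace l 2)

/-- `S X = X - (a₂ / (1 + a₂ d)) tr (X) I`. -/
def S {d : ℕ} (l : Fin d → ℝ) (X : Matrix (Fin d) (Fin d) ℝ) :
    Matrix (Fin d) (Fin d) ℝ :=
  X - (a₂ l / (1 + a₂ l * (d : ℝ)) * X.trace) • (1 : Matrix (Fin d) (Fin d) ℝ)

end

end RandomCubature

/-! The quadratic form `X ↦ ∫ ⟨A, X⟩² dσ(A)` is invariant under orthogonal conjugation, so on
symmetric `X` the spectral theorem reduces it to diagonal matrices. There invariance under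
permutation matrices leaves only `α ⟨X, X⟩ + β (tr X)²` (`exists_uniformTraceMoment_eq`). A
strength-2 cubature has the same form, and polarization gives `E(⟨P, X⟩ P) = α X + β tr(X) I`
(`expectation_hsInner_smul`).

No Haar integral is evaluated: `tr P = s₁` and `⟨P, P⟩ = s₂` on the orbit give two linear equations
for `α` and `β`, whence `a₁ α = 1` and `a₁ β = a₂`. So `a₁ E(⟨P, X⟩ P) = X + a₂ tr(X) I`, a
perturbation of the identity by a multiple of `tr(X) I`, and `S` is its inverse since `1 + a₂ d ≠
0`. -/

namespace RandomCubature

/-! ### Hilbert-Schmidt pairing and symmetric matrix units -/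

section Matrices

variable {d : ℕ}

theorem hsInner_eq_sum (A B : Matrix (Fin d) (Fin d) ℝ) :
    hsInner A B = ∑ i, ∑ j, A i j * B i j := by
  simp [hsInner, Matrix.trace, Matrix.mul_apply]

theorem continuous_hsInner (X : Matrix (Fin d) (Fin d) ℝ) :
    Continuous fun A : Matrix (Fin d) (Fin d) ℝ => hsInner A X := by
  unfold hsInner
  fun_prop

theorem hsInner_add_right (A X Y : Matrix (Fin d) (Fin d) ℝ) :
    hsInner A (X + Y) = hsInner A X + hsInner A Y := by
  simp [hsInner, Matrix.mul_add]

theorem hsInner_sub_right (A X Y : Matrix (Fin d) (Fin d) ℝ) :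
    hsInner A (X - Y) = hsInner A X - hsInner A Y := by
  simp [hsInner, Matrix.mul_sub]

theorem hsInner_one_right (A : Matrix (Fin d) (Fin d) ℝ) : hsInner A 1 = A.trace := by
  simp [hsInner]

theorem hsInner_diagonal_right (A : Matrix (Fin d) (Fin d) ℝ) (x : Fin d → ℝ) :
    hsInner A (Matrix.diagonal x) = ∑ i, x i * A i i := by
  simp [hsInner, Matrix.trace, mul_comm]

theorem hsInner_comm (A B : Matrix (Fin d) (Fin d) ℝ) : hsInner A B = hsInner B A := by
  simp [hsInner_eq_sum, mul_comm]

/-- The symmetric matrix unit `E_ij + E_ji`. -/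
noncomputable def symmSingle (i j : Fin d) : Matrix (Fin d) (Fin d) ℝ :=
  Matrix.single i j 1 + Matrix.single j i 1

theorem isSymm_symmSingle (i j : Fin d) : (symmSingle i j).IsSymm := by
  simp [symmSingle, Matrix.IsSymm, Matrix.transpose_add, add_comm]

theorem hsInner_symmSingle {A : Matrix (Fin d) (Fin d) ℝ} (hA : A.IsSymm) (i j : Fin d) :
    hsInner A (symmSingle i j) = 2 * A i j := by
  have h : ∀ i j : Fin d, hsInner A (Matrix.single i j 1) = A i j := fun i j => by
    simp [hsInner, Matrix.trace_mul_single]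
  rw [symmSingle, hsInner_add_right, h, h, hA.apply, two_mul]

theorem trace_symmSingle (i j : Fin d) :
    (symmSingle i j).trace = 2 * (1 : Matrix (Fin d) (Fin d) ℝ) i j := by
  rw [← hsInner_symmSingle Matrix.isSymm_one, hsInner_comm, hsInner_one_right]

theorem hsInner_symmSingle_self (i j : Fin d) :
    hsInner (symmSingle i j) (symmSingle i j) =
      2 + 2 * (1 : Matrix (Fin d) (Fin d) ℝ) i j := by
  rw [hsInner_symmSingle (isSymm_symmSingle i j)]
  by_cases h : i = j
  · subst h; simp [symmSingle]; norm_num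
  · simp [symmSingle, h, Ne.symm h]

end Matrices

/-! ### Geometry of the orbit -/

section Orbit

variable {d : ℕ} {l : Fin d → ℝ}

theorem continuous_conjDiag (l : Fin d → ℝ) : Continuous (conjDiag l) := by
  unfold conjDiag
  fun_prop

theorem isCompact_orbit (l : Fin d → ℝ) : IsCompact (orbit l) :=
  isCompact_range (continuous_conjDiag l)

theorem isSymm_of_mem_orbit {A : Matrix (Fin d) (Fin d) ℝ} (hA : A ∈ orbit l) : A.IsSymm := by
  obtain ⟨O, rfl⟩ := hA
  simp [Matrix.IsSymm, conjDiag, Matrix.mul_assoc]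

theorem transpose_mul_self (O : Matrix.orthogonalGroup (Fin d) ℝ) :
    (O : Matrix (Fin d) (Fin d) ℝ)ᵀ * (O : Matrix (Fin d) (Fin d) ℝ) = 1 :=
  (Matrix.mem_orthogonalGroup_iff' (Fin d) ℝ).mp O.2

theorem trace_conj (O : Matrix.orthogonalGroup (Fin d) ℝ) (A : Matrix (Fin d) (Fin d) ℝ) :
    ((O : Matrix (Fin d) (Fin d) ℝ) * A * (O : Matrix (Fin d) (Fin d) ℝ)ᵀ).trace = A.trace := by
  rw [Matrix.trace_mul_comm, ← Matrix.mul_assoc, transpose_mul_self, Matrix.one_mul]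

theorem hsInner_conj (O : Matrix.orthogonalGroup (Fin d) ℝ) (A B : Matrix (Fin d) (Fin d) ℝ) :
    hsInner ((O : Matrix (Fin d) (Fin d) ℝ) * A * (O : Matrix (Fin d) (Fin d) ℝ)ᵀ)
      ((O : Matrix (Fin d) (Fin d) ℝ) * B * (O : Matrix (Fin d) (Fin d) ℝ)ᵀ) = hsInner A B := by
  have h : ((O : Matrix (Fin d) (Fin d) ℝ) * A * (O : Matrix (Fin d) (Fin d) ℝ)ᵀ) *
      ((O : Matrix (Fin d) (Fin d) ℝ) * B * (O : Matrix (Fin d) (Fin d) ℝ)ᵀ)ᵀ =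
      (O : Matrix (Fin d) (Fin d) ℝ) * (A * Bᵀ) * (O : Matrix (Fin d) (Fin d) ℝ)ᵀ := by
    simp only [Matrix.transpose_mul, Matrix.transpose_transpose, Matrix.mul_assoc]
    rw [← Matrix.mul_assoc _ (O : Matrix (Fin d) (Fin d) ℝ), transpose_mul_self, Matrix.one_mul]
  rw [hsInner, h, trace_conj, hsInner]

theorem trace_of_mem_orbit {A : Matrix (Fin d) (Fin d) ℝ} (hA : A ∈ orbit l) :
    A.trace = powerTrace l 1 := by
  obtain ⟨O, rfl⟩ := hA
  rw [conjDiag, trace_conj, powerTrace, pow_one]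

theorem hsInner_self_of_mem_orbit {A : Matrix (Fin d) (Fin d) ℝ} (hA : A ∈ orbit l) :
    hsInner A A = powerTrace l 2 := by
  obtain ⟨O, rfl⟩ := hA
  rw [conjDiag, hsInner_conj, powerTrace, hsInner, Matrix.diagonal_transpose, sq]

theorem conjDiag_mul (U O : Matrix.orthogonalGroup (Fin d) ℝ) :
    conjDiag l (U * O) = (U : Matrix (Fin d) (Fin d) ℝ) * conjDiag l O *
      (U : Matrix (Fin d) (Fin d) ℝ)ᵀ := by
  simp [conjDiag, Matrix.mul_assoc]

/-- A continuous function is bounded on the compact orbit. -/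
theorem integrable_comp_of_mem_orbit {Ω : Type*} [MeasurableSpace Ω] {μ : Measure Ω}
    [IsFiniteMeasure μ] {P : Ω → Matrix (Fin d) (Fin d) ℝ} (hP : Measurable P)
    (hmem : ∀ ω, P ω ∈ orbit l) {f : Matrix (Fin d) (Fin d) ℝ → ℝ} (hf : Continuous f) :
    Integrable (fun ω => f (P ω)) μ := by
  obtain ⟨C, hC⟩ := (isCompact_orbit l).exists_bound_of_continuousOn hf.continuousOn
  exact Integrable.of_bound (hf.measurable.comp hP).aestronglyMeasurable C
    (Filter.Eventually.of_forall fun ω => hC _ (hmem ω))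

end Orbit

/-! ### Second moments of the invariant measure -/

section Haar

variable {d : ℕ}

instance instIsProbabilityMeasureOrthogonalHaar (d : ℕ) :
    IsProbabilityMeasure (orthogonalHaar d) :=
  ⟨by simpa [orthogonalHaar] using
    Measure.haarMeasure_self (K₀ := (⊤ : TopologicalSpace.PositiveCompacts
      (Matrix.orthogonalGroup (Fin d) ℝ)))⟩

instance instIsMulLeftInvariantOrthogonalHaar (d : ℕ) :
    (orthogonalHaar d).IsMulLeftInvariant :=
  inferInstanceAs (Measure.haarMeasure ⊤).IsMulLeftInvariant

theorem measurable_conjDiag (l : Fin d → ℝ) : Measurable (conjDiag l) :=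
  (continuous_conjDiag l).measurable

theorem uniformTraceMoment_eq_traceMoment (l : Fin d → ℝ) (t : ℕ)
    (X : Matrix (Fin d) (Fin d) ℝ) :
    uniformTraceMoment l t X = traceMoment (orthogonalHaar d) (conjDiag l) t X := by
  rw [uniformTraceMoment, orbitMeasure, traceMoment,
    integral_map (measurable_conjDiag l).aemeasurable
      (f := fun A => hsInner A X ^ t) ((continuous_hsInner X).pow t).aestronglyMeasurable]

/-- Integrals of functions of `O D Oᵀ` are invariant under orthogonal conjugation. -/
theorem integral_conj_conjDiag (l : Fin d → ℝ) (U : Matrix.orthogonalGroup (Fin d) ℝ)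
    (f : Matrix (Fin d) (Fin d) ℝ → ℝ) :
    ∫ O, f ((U : Matrix (Fin d) (Fin d) ℝ) * conjDiag l O *
      (U : Matrix (Fin d) (Fin d) ℝ)ᵀ) ∂(orthogonalHaar d) =
      ∫ O, f (conjDiag l O) ∂(orthogonalHaar d) := by
  simp_rw [← conjDiag_mul]
  exact integral_mul_left_eq_self (fun O => f (conjDiag l O)) U

/-- The orthogonal matrix of a permutation. -/
noncomputable def permOrthogonal (σ : Equiv.Perm (Fin d)) : Matrix.orthogonalGroup (Fin d) ℝ :=
  ⟨σ.permMatrix ℝ, by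
    rw [Matrix.mem_orthogonalGroup_iff, Matrix.transpose_permMatrix, ← Matrix.permMatrix_mul]
    simp⟩

theorem permOrthogonal_conj_apply (σ : Equiv.Perm (Fin d)) (A : Matrix (Fin d) (Fin d) ℝ)
    (i j : Fin d) :
    ((permOrthogonal σ : Matrix (Fin d) (Fin d) ℝ) * A *
      (permOrthogonal σ : Matrix (Fin d) (Fin d) ℝ)ᵀ) i j = A (σ i) (σ j) := by
  simp [permOrthogonal, Matrix.transpose_permMatrix, Equiv.Perm.permMatrix,
    PEquiv.toMatrix_toPEquiv_mul, PEquiv.mul_toMatrix_toPEquiv, ← Equiv.Perm.inv_def]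

/-- The mixed second moment of two diagonal entries of `O D Oᵀ`. -/
noncomputable def diagMoment (l : Fin d → ℝ) (i j : Fin d) : ℝ :=
  ∫ O, conjDiag l O i i * conjDiag l O j j ∂(orthogonalHaar d)

theorem diagMoment_perm (l : Fin d → ℝ) (σ : Equiv.Perm (Fin d)) (i j : Fin d) :
    diagMoment l (σ i) (σ j) = diagMoment l i j := by
  have h := integral_conj_conjDiag l (permOrthogonal σ) (fun A => A i i * A j j)
  simpa only [permOrthogonal_conj_apply, diagMoment] using h

/-- Permutations act transitively on the pairs `(i, i)` and on the pairs `(i, j)` with `i ≠ j`, so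
only two values occur. -/
theorem exists_diagMoment_eq (hd : 2 ≤ d) (l : Fin d → ℝ) :
    ∃ α β : ℝ, ∀ i j, diagMoment l i j = (if i = j then α else 0) + β := by
  let p : Fin d := ⟨0, by omega⟩
  let q : Fin d := ⟨1, by omega⟩
  have hpq : p ≠ q := by simp [p, q]
  refine ⟨diagMoment l p p - diagMoment l p q, diagMoment l p q, fun i j => ?_⟩
  by_cases hij : i = j
  · subst hij
    have h := diagMoment_perm l (Equiv.swap p i) p p
    rw [Equiv.swap_apply_left] at h
    simp [h]
  · obtain ⟨σ, hσi, hσj⟩ : ∃ σ : Equiv.Perm (Fin d), σ p = i ∧ σ q = j := by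
      -- The first swap takes `p` to `i`; the second takes the image of `q` to `j` and fixes `i`,
      -- which differs from both.
      refine ⟨(Equiv.swap p i).trans (Equiv.swap (Equiv.swap p i q) j), ?_, ?_⟩
      · rw [Equiv.trans_apply, Equiv.swap_apply_left]
        refine Equiv.swap_apply_of_ne_of_ne (fun h => hpq ?_) hij
        apply (Equiv.swap p i).injective
        rw [Equiv.swap_apply_left, ← h]
      · simp
    have h := diagMoment_perm l σ p q
    rw [hσi, hσj] at h
    simp [h, hij]

/-- A real symmetric matrix is orthogonally diagonalizable. -/
theorem exists_orthogonal_diagonal {X : Matrix (Fin d) (Fin d) ℝ} (hX : X.IsSymm) :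
    ∃ (U : Matrix.orthogonalGroup (Fin d) ℝ) (x : Fin d → ℝ),
      X = (U : Matrix (Fin d) (Fin d) ℝ) * Matrix.diagonal x *
        (U : Matrix (Fin d) (Fin d) ℝ)ᵀ := by
  have hH : X.IsHermitian := by
    rw [Matrix.IsHermitian, Matrix.conjTranspose_eq_transpose_of_trivial]; exact hX
  refine ⟨hH.eigenvectorUnitary, hH.eigenvalues, ?_⟩
  conv_lhs => rw [hH.spectral_theorem]
  simp [Unitary.conjStarAlgAut_apply, Matrix.star_eq_conjTranspose]

theorem traceMoment_conjDiag_diagonal (l x : Fin d → ℝ) :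
    traceMoment (orthogonalHaar d) (conjDiag l) 2 (Matrix.diagonal x) =
      ∑ i, ∑ j, x i * x j * diagMoment l i j := by
  have h : ∀ O, hsInner (conjDiag l O) (Matrix.diagonal x) ^ 2 =
      ∑ i, ∑ j, x i * x j * (conjDiag l O i i * conjDiag l O j j) := fun O => by
    rw [hsInner_diagonal_right, sq, Finset.sum_mul_sum]
    exact Finset.sum_congr rfl fun i _ => Finset.sum_congr rfl fun j _ => by ring
  have hint : ∀ i j, Integrable
      (fun O => x i * x j * (conjDiag l O i i * conjDiag l O j j)) (orthogonalHaar d) :=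
    fun i j => integrable_comp_of_mem_orbit (l := l)
      (f := fun A => x i * x j * (A i i * A j j)) (measurable_conjDiag l)
      (fun O => ⟨O, rfl⟩) (by fun_prop)
  simp_rw [traceMoment, h]
  rw [integral_finsetSum _ fun i _ => integrable_finsetSum _ fun j _ => hint i j]
  refine Finset.sum_congr rfl fun i _ => ?_
  rw [integral_finsetSum _ fun j _ => hint i j]
  exact Finset.sum_congr rfl fun j _ => by rw [integral_const_mul, diagMoment]

theorem exists_uniformTraceMoment_eq (hd : 2 ≤ d) (l : Fin d → ℝ) :
    ∃ α β : ℝ, ∀ X : Matrix (Fin d) (Fin d) ℝ, X.IsSymm →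
      uniformTraceMoment l 2 X = α * hsInner X X + β * X.trace ^ 2 := by
  obtain ⟨α, β, h⟩ := exists_diagMoment_eq hd l
  refine ⟨α, β, fun X hX => ?_⟩
  obtain ⟨U, x, rfl⟩ := exists_orthogonal_diagonal hX
  rw [uniformTraceMoment_eq_traceMoment, hsInner_conj, trace_conj, traceMoment,
    -- Translating the Haar variable by `U` cancels the eigenvector matrix of `X`.
    ← integral_conj_conjDiag l U (fun A => hsInner A _ ^ 2)]
  simp_rw [hsInner_conj]
  rw [← traceMoment, traceMoment_conjDiag_diagonal, hsInner_diagonal_right, Matrix.trace_diagonal,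
    sq (∑ i, x i), Finset.sum_mul_sum]
  simp_rw [h, mul_add, Finset.sum_add_distrib, mul_ite, mul_zero, Finset.sum_ite_eq,
    Finset.mul_sum]
  simp [mul_comm]

end Haar

/-! ### Averaging operator and the equations for its coefficients -/

section QuadraticMoments

variable {Ω : Type*} [MeasurableSpace Ω] {μ : Measure Ω} [IsProbabilityMeasure μ] {d : ℕ}
  {l : Fin d → ℝ} {P : Ω → Matrix (Fin d) (Fin d) ℝ} {α β : ℝ}

theorem integral_hsInner_mul_hsInner (hP : Measurable P) (hmem : ∀ ω, P ω ∈ orbit l)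
    (hQ : ∀ X : Matrix (Fin d) (Fin d) ℝ, X.IsSymm →
      traceMoment μ P 2 X = α * hsInner X X + β * X.trace ^ 2)
    {X Y : Matrix (Fin d) (Fin d) ℝ} (hX : X.IsSymm) (hY : Y.IsSymm) :
    ∫ ω, hsInner (P ω) X * hsInner (P ω) Y ∂μ =
      α * hsInner X Y + β * (X.trace * Y.trace) := by
  have hint : ∀ Z : Matrix (Fin d) (Fin d) ℝ, Integrable (fun ω => hsInner (P ω) Z ^ 2) μ :=
    fun Z => integrable_comp_of_mem_orbit hP hmem ((continuous_hsInner Z).pow 2)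
  have h1 := hQ (X + Y) (hX.add hY)
  have h2 := hQ (X - Y) (hX.sub hY)
  have h3 : ∫ ω, hsInner (P ω) X * hsInner (P ω) Y ∂μ =
      (traceMoment μ P 2 (X + Y) - traceMoment μ P 2 (X - Y)) / 4 := by
    rw [traceMoment, traceMoment, ← integral_sub (hint _) (hint _), ← integral_div]
    refine integral_congr_ae (Filter.Eventually.of_forall fun ω => ?_)
    simp only [hsInner_add_right, hsInner_sub_right]
    ring
  rw [h3, h1, h2]
  simp only [hsInner_add_right, hsInner_sub_right, hsInner_comm (X + Y),
    hsInner_comm (X - Y), Matrix.trace_add, Matrix.trace_sub, hsInner_comm Y X]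
  ring

/-- Pairing the polarized identity with `E_ij + E_ji` reads off twice the `(i, j)` entry. -/
theorem expectation_hsInner_smul (hP : Measurable P) (hmem : ∀ ω, P ω ∈ orbit l)
    (hQ : ∀ X : Matrix (Fin d) (Fin d) ℝ, X.IsSymm →
      traceMoment μ P 2 X = α * hsInner X X + β * X.trace ^ 2)
    {X : Matrix (Fin d) (Fin d) ℝ} (hX : X.IsSymm) :
    expectation μ (fun ω => hsInner (P ω) X • P ω) =
      α • X + (β * X.trace) • (1 : Matrix (Fin d) (Fin d) ℝ) := by
  ext i j
  have h := integral_hsInner_mul_hsInner hP hmem hQ hX (isSymm_symmSingle i j)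
  have h2 : ∀ ω, hsInner (P ω) X * hsInner (P ω) (symmSingle i j) =
      2 * (hsInner (P ω) X * P ω i j) := fun ω => by
    rw [hsInner_symmSingle (isSymm_of_mem_orbit (hmem ω))]; ring
  simp_rw [h2] at h
  rw [integral_const_mul, hsInner_symmSingle hX, trace_symmSingle] at h
  simp only [expectation, Matrix.of_apply, Matrix.smul_apply, Matrix.add_apply, smul_eq_mul]
  linarith

theorem coeff_eq_of_trace (hmem : ∀ ω, P ω ∈ orbit l)
    (hQ : ∀ X : Matrix (Fin d) (Fin d) ℝ, X.IsSymm →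
      traceMoment μ P 2 X = α * hsInner X X + β * X.trace ^ 2) :
    α * d + β * (d : ℝ) ^ 2 = powerTrace l 1 ^ 2 := by
  have h := hQ 1 Matrix.isSymm_one
  simp_rw [traceMoment, hsInner_one_right, trace_of_mem_orbit (hmem _)] at h
  simpa using h.symm

/-- The second moments of all entries sum to `E⟨P, P⟩ = s₂`. -/
theorem coeff_eq_of_norm (hP : Measurable P) (hmem : ∀ ω, P ω ∈ orbit l)
    (hQ : ∀ X : Matrix (Fin d) (Fin d) ℝ, X.IsSymm →
      traceMoment μ P 2 X = α * hsInner X X + β * X.trace ^ 2) :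
    α * (d * (d + 1)) + 2 * β * d = 2 * powerTrace l 2 := by
  -- The quadratic form at `E_ij + E_ji` gives `4 E(P_ij²) = α (2 + 2 δ_ij) + 4 β δ_ij²`.
  have hentry : ∀ i j, ∫ ω, P ω i j * P ω i j ∂μ =
      α / 2 + (α / 2 + β) * (1 : Matrix (Fin d) (Fin d) ℝ) i j := fun i j => by
    have h := hQ _ (isSymm_symmSingle i j)
    simp_rw [traceMoment, hsInner_symmSingle (isSymm_of_mem_orbit (hmem _)), mul_pow] at h
    rw [integral_const_mul, hsInner_symmSingle_self, trace_symmSingle] at h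
    have h1 : (1 : Matrix (Fin d) (Fin d) ℝ) i j ^ 2 = (1 : Matrix (Fin d) (Fin d) ℝ) i j := by
      by_cases hij : i = j <;> simp [Matrix.one_apply, hij]
    simp_rw [← sq]
    rw [mul_pow, h1] at h
    linarith
  have hint : ∀ i j, Integrable (fun ω => P ω i j * P ω i j) μ := fun i j =>
    integrable_comp_of_mem_orbit (f := fun A => A i j * A i j) hP hmem (by fun_prop)
  have h : ∫ ω, hsInner (P ω) (P ω) ∂μ = powerTrace l 2 := by
    simp_rw [hsInner_self_of_mem_orbit (hmem _)]
    simp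
  simp_rw [hsInner_eq_sum] at h
  rw [integral_finsetSum _ fun i _ => integrable_finsetSum _ fun j _ => hint i j] at h
  simp_rw [integral_finsetSum _ fun j _ => hint _ j, hentry, Matrix.one_apply] at h
  simp [Finset.sum_add_distrib] at h
  linarith

end QuadraticMoments

/-! ### Nondegeneracy of the spectrum -/

section Spectrum

variable {d k : ℕ} {l : Fin d → ℝ}

theorem powerTrace_eq_sum (l : Fin d → ℝ) (n : ℕ) : powerTrace l n = ∑ i, l i ^ n := by
  simp [powerTrace, Matrix.diagonal_pow]

theorem IsSpectrum.nonneg (hl : IsSpectrum k l) (i : Fin d) : 0 ≤ l i :=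
  (lt_or_ge (i : ℕ) k).elim (fun h => (hl.pos i h).le) fun h => (hl.eq_zero i h).ge

theorem IsSpectrum.powerTrace_one_pos (hl : IsSpectrum k l) : 0 < powerTrace l 1 := by
  rw [powerTrace_eq_sum]
  simp_rw [pow_one]
  have h0 : 0 < d := hl.one_le.trans hl.le_dim
  exact Finset.sum_pos' (fun i _ => hl.nonneg i)
    ⟨⟨0, h0⟩, Finset.mem_univ _, hl.pos ⟨0, h0⟩ hl.one_le⟩

theorem IsSpectrum.exists_ne (hl : IsSpectrum k l) (hne : k = d → ∃ i j, l i ≠ l j) :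
    ∃ i j, l i ≠ l j := by
  rcases hl.le_dim.eq_or_lt with h | h
  · exact hne h
  -- Indices start at zero, so index `k` carries `λ_{k+1} = 0`.
  · refine ⟨⟨0, by omega⟩, ⟨k, h⟩, ?_⟩
    rw [hl.eq_zero ⟨k, h⟩ le_rfl]
    exact (hl.pos ⟨0, _⟩ hl.one_le).ne'

/-- Strict Cauchy-Schwarz: the gap is half the sum of all `(l i - l j)²`. -/
theorem powerTrace_one_sq_lt (h : ∃ i j, l i ≠ l j) :
    powerTrace l 1 ^ 2 < d * powerTrace l 2 := by
  obtain ⟨p, q, hpq⟩ := h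
  have hpos : 0 < ∑ i, ∑ j, (l i - l j) ^ 2 :=
    Finset.sum_pos' (fun i _ => Finset.sum_nonneg fun j _ => sq_nonneg _)
      ⟨p, Finset.mem_univ _, Finset.sum_pos' (fun j _ => sq_nonneg _)
        ⟨q, Finset.mem_univ _, sq_pos_of_ne_zero (sub_ne_zero.mpr hpq)⟩⟩
  have hexp : ∑ i, ∑ j, (l i - l j) ^ 2 = 2 * (d * powerTrace l 2 - powerTrace l 1 ^ 2) := by
    simp_rw [powerTrace_eq_sum, sub_sq, Finset.sum_add_distrib, Finset.sum_sub_distrib, pow_one,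
      ← Finset.mul_sum, ← Finset.sum_mul]
    simp [← Finset.mul_sum]
    ring
  linarith

end Spectrum

/-! ### Inversion of the averaging operator -/

theorem isSymm_S {d : ℕ} (l : Fin d → ℝ) {X : Matrix (Fin d) (Fin d) ℝ} (hX : X.IsSymm) :
    (S l X).IsSymm :=
  hX.sub (Matrix.isSymm_one.smul _)

theorem trace_S {d : ℕ} {l : Fin d → ℝ} (h : 1 + a₂ l * d ≠ 0)
    (X : Matrix (Fin d) (Fin d) ℝ) : (S l X).trace = X.trace / (1 + a₂ l * d) := by
  simp only [S, Matrix.trace_sub, Matrix.trace_smul, Matrix.trace_one, Fintype.card_fin,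
    smul_eq_mul]
  field_simp
  ring

theorem S_add_trace_smul_one {d : ℕ} {l : Fin d → ℝ} (h : 1 + a₂ l * d ≠ 0)
    (X : Matrix (Fin d) (Fin d) ℝ) :
    S l (X + (a₂ l * X.trace) • (1 : Matrix (Fin d) (Fin d) ℝ)) = X := by
  simp only [S, Matrix.trace_add, Matrix.trace_smul, Matrix.trace_one, Fintype.card_fin,
    smul_eq_mul]
  rw [add_sub_assoc, ← sub_smul, add_eq_left]
  convert zero_smul ℝ _
  field_simp
  ring

theorem S_add_trace_S_smul_one {d : ℕ} {l : Fin d → ℝ} (h : 1 + a₂ l * d ≠ 0)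
    (X : Matrix (Fin d) (Fin d) ℝ) :
    S l X + (a₂ l * (S l X).trace) • (1 : Matrix (Fin d) (Fin d) ℝ) = X := by
  rw [trace_S h, S, sub_add, ← sub_smul, sub_eq_self]
  convert zero_smul ℝ _
  ring

/-- The averaging operator of a random cubature of strength `2`. -/
theorem IsRandomCubature.a₁_smul_expectation {Ω : Type*} [MeasurableSpace Ω] {μ : Measure Ω}
    [IsProbabilityMeasure μ] {d : ℕ} (hd : 2 ≤ d) {l : Fin d → ℝ} (hl : ∃ i j, l i ≠ l j)
    {P : Ω → Matrix (Fin d) (Fin d) ℝ} (hP : IsRandomCubature μ l 2 P)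
    {X : Matrix (Fin d) (Fin d) ℝ} (hX : X.IsSymm) :
    a₁ l • expectation μ (fun ω => hsInner (P ω) X • P ω) =
      X + (a₂ l * X.trace) • (1 : Matrix (Fin d) (Fin d) ℝ) := by
  obtain ⟨α, β, h⟩ := exists_uniformTraceMoment_eq hd l
  have hQ : ∀ X : Matrix (Fin d) (Fin d) ℝ, X.IsSymm →
      traceMoment μ P 2 X = α * hsInner X X + β * X.trace ^ 2 :=
    fun X hX => (hP.moment_eq X hX).trans (h X hX)
  have h1 := coeff_eq_of_trace hP.mem_orbit hQ
  have h2 := coeff_eq_of_norm hP.measurable hP.mem_orbit hQ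
  have hlt := powerTrace_one_sq_lt hl
  have hden : -2 * powerTrace l 1 ^ 2 + 2 * (d : ℝ) * powerTrace l 2 ≠ 0 := by
    apply ne_of_gt; linarith
  have hα : a₁ l * α = 1 := by
    rw [a₁, div_mul_eq_mul_div, div_eq_one_iff_eq hden]
    -- This combination eliminates `β`; the one for `hβ` eliminates `α`. Both leave the factor `d (d
    -- + 2) (d - 1)`.
    linear_combination (d : ℝ) * h2 - 2 * h1
  have hβ : a₁ l * β = a₂ l := by
    rw [a₁, a₂, div_mul_eq_mul_div, div_left_inj' hden]
    linear_combination ((d : ℝ) + 1) * h1 - h2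
  rw [expectation_hsInner_smul hP.measurable hP.mem_orbit hQ hX, smul_add, smul_smul, smul_smul,
    hα, one_smul, ← mul_assoc, hβ]

/-- Over the common denominator the `s₂` terms cancel, leaving the positive numerator `s₁² (d - 1)
(d + 2)`. -/
theorem one_add_a₂_mul_ne_zero {d k : ℕ} (hd : 2 ≤ d) {l : Fin d → ℝ} (hl : IsSpectrum k l)
    (hne : ∃ i j, l i ≠ l j) : 1 + a₂ l * d ≠ 0 := by
  have hlt := powerTrace_one_sq_lt hne
  have hden : 0 < -2 * powerTrace l 1 ^ 2 + 2 * (d : ℝ) * powerTrace l 2 := by linarith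
  have hs := hl.powerTrace_one_pos
  have hd' : (2 : ℝ) ≤ d := by exact_mod_cast hd
  have h : 1 + a₂ l * d = (powerTrace l 1 ^ 2 * ((d - 1) * (d + 2))) /
      (-2 * powerTrace l 1 ^ 2 + 2 * (d : ℝ) * powerTrace l 2) := by
    rw [a₂, div_mul_eq_mul_div, one_add_div hden.ne']
    ring
  rw [h]
  have : (0 : ℝ) < d - 1 := by linarith
  positivity

end RandomCubature

/-- The last hypothesis, that the entries of `l` are not all equal, is only required if
`k = d`; for `k < d` it holds automatically. -/
theorem corollary7p5 {Ω : Type*} [MeasurableSpace Ω] (μ : MeasureTheory.Measure Ω)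
    [MeasureTheory.IsProbabilityMeasure μ] (d k : ℕ) (hd : 2 ≤ d) (l : Fin d → ℝ)
    (hl : RandomCubature.IsSpectrum k l) (hne : k = d → ∃ i j, l i ≠ l j)
    (P : Ω → Matrix (Fin d) (Fin d) ℝ) (hP : RandomCubature.IsRandomCubature μ l 2 P)
    (X : Matrix (Fin d) (Fin d) ℝ) (hX : X.IsSymm) :
    (RandomCubature.S l X).IsSymm ∧
    RandomCubature.S l (RandomCubature.a₁ l •
        RandomCubature.expectation μ (fun ω => RandomCubature.hsInner (P ω) X • P ω)) = X ∧
    RandomCubature.a₁ l • RandomCubature.expectation μ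
        (fun ω => RandomCubature.hsInner (P ω) (RandomCubature.S l X) • P ω) = X := by
  have hne' := hl.exists_ne hne
  have h := RandomCubature.one_add_a₂_mul_ne_zero hd hl hne'
  refine ⟨RandomCubature.isSymm_S l hX, ?_, ?_⟩
  · rw [hP.a₁_smul_expectation hd hne' hX, RandomCubature.S_add_trace_smul_one h]
  · rw [hP.a₁_smul_expectation hd hne' (RandomCubature.isSymm_S l hX),
      RandomCubature.S_add_trace_S_smul_one h]
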